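/- Let $V$ be a finite set, let $\mathcal{M}=(V,\mathcal{I})$ be a matroid, and let $G=(V,E)$ be a hypergraph (each $e\in E$ is a subset of $V$) with hyperedge weights $w:E\to\mathbb{R}_{\ge 0}$, such that $|e|\le\mu$ for all $e\in E$, where $\mu\ge 0$ is an integer. For $A\subseteq E$ put $w(A)=\sum_{e\in A}w(e)$; for $v\in V$ put $\deg_w(v)=w(\{e\in E: v\in e\})$; for $S\subseteq V$ put $E(S)=\{e\in E: e\cap S\neq\emptyset\}$. In a matroid $\mathcal{N}$, the density of a set $U$ is $\rho_{\mathcal{N}}(U)=|U|/\mathrm{rank}_{\mathcal{N}}(U)$, with $\rho_{\mathcal{N}}(\emptyset)=0$ and $\rho_{\mathcal{N}}(U)=+\infty$ if $U\ne\emptyset$ has rank $0$. The largest densest subset of a set $C$ with respect to $\mathcal{N}$ is the subset of maximum cardinality among the subsets of $C$ that have maximum density. Let $\rho$ be a positive integer, and let $V'$ be the set returned by the following algorithm. Enumerate $V=\{v_1,\dots,v_n\}$ so that $\deg_w(v_1)\ge\dots\ge\deg_w(v_n)$ (ties broken arbitrarily), and start with $V'=C=\emptyset$. For $i=1,\dots,n$: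 if $v_i\in\mathrm{span}_{\mathcal{M}}(V')$, skip $v_i$; otherwise add $v_i$ to $C$, let $X$ be the largest densest subset of $C$ with respect to the contracted matroid $\mathcal{M}/V'$, and if $\rho_{\mathcal{M}/V'}(X)\ge\rho$, remove $X$ from $C$ and add it to $V'$. After the loop, return $V'\cup C$. Let $O$ be an optimal solution, i.e. a set $O\in\mathcal{I}$ with $w(E(O))=\max_{S\in\mathcal{I}}w(E(S))$. Then there is a set $S\subseteq V'$ with $S\in\mathcal{I}$ and \[ w(E(S))\ \ge\ \Bigl(1-\frac{\mu-1}{\rho}\Bigr)\,w(E(O)). \] -/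

import Mathlib

namespace MatroidCoverage

/-- The density of `U` in the matroid `M`, that is `|U| / rank_M(U)`. By the conventions of
`ℝ≥0∞` the empty set has density `0` and a nonempty set of rank `0` has density `∞`
(see the next two lemmas). -/
noncomputable def density {V : Type*} (M : Matroid V) (U : Finset V) : ENNReal :=
  (U.card : ENNReal) / ((M.eRk (U : Set V) : ℕ∞) : ENNReal)

theorem density_empty {V : Type*} (M : Matroid V) : density M ∅ = 0 := by
  simp [density]

theorem density_eq_top {V : Type*} (M : Matroid V) {U : Finset V} (hU : U.Nonempty)
    (h : M.eRk (U : Set V) = 0) : density M U = ⊤ := by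
  simp only [density, h, ENat.toENNReal_zero]
  exact ENNReal.div_zero (by exact_mod_cast hU.card_pos.ne')

/-- `X` is a densest subset of `C`: it has maximum density in `M` among all subsets of `C`. -/
def IsDensest {V : Type*} (M : Matroid V) (C X : Finset V) : Prop :=
  X ⊆ C ∧ ∀ U, U ⊆ C → density M U ≤ density M X

/-- `X` is a largest densest subset of `C`: a densest subset of maximum cardinality. -/
def IsLargestDensest {V : Type*} (M : Matroid V) (C X : Finset V) : Prop :=
  IsDensest M C X ∧ ∀ Y, IsDensest M C Y → Y.card ≤ X.card

theorem exists_isLargestDensest {V : Type*} (M : Matroid V) (C : Finset V) :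
    ∃ X, IsLargestDensest M C X := by
  classical
  obtain ⟨D, hD, hDmax⟩ := C.powerset.exists_max_image (density M) ⟨∅, by simp⟩
  have hDd : IsDensest M C D :=
    ⟨Finset.mem_powerset.1 hD, fun U hU => hDmax U (Finset.mem_powerset.2 hU)⟩
  obtain ⟨X, hX, hXmax⟩ := (C.powerset.filter (IsDensest M C)).exists_max_image Finset.card
    ⟨D, Finset.mem_filter.2 ⟨hD, hDd⟩⟩
  exact ⟨X, (Finset.mem_filter.1 hX).2, fun Y hY =>
    hXmax Y (Finset.mem_filter.2 ⟨Finset.mem_powerset.2 hY.1, hY⟩)⟩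

/-- The largest densest subset of `C` with respect to `M`. -/
noncomputable def largestDensest {V : Type*} (M : Matroid V) (C : Finset V) : Finset V :=
  (exists_isLargestDensest M C).choose

theorem largestDensest_spec {V : Type*} (M : Matroid V) (C : Finset V) :
    IsLargestDensest M C (largestDensest M C) :=
  (exists_isLargestDensest M C).choose_spec

/-- The two sets maintained by the kernel construction: `V'` and `C`. -/
structure KernelState (V : Type*) where
  kernel : Finset V
  candidates : Finset V

open Classical in
/-- One iteration of the main loop, processing the element `v`: ignore `v` if it is spanned by
`V'`; otherwise add it to `C`, let `X` be the largest densest subset of `C` with respect to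
`M / V'`, and if its density is at least `ρ`, move `X` from `C` to `V'`. -/
noncomputable def kernelStep {V : Type*} [DecidableEq V] (M : Matroid V) (ρ : ℕ)
    (s : KernelState V) (v : V) : KernelState V :=
  if v ∈ M.closure (s.kernel : Set V) then s
  else
    let N := M.contract (s.kernel : Set V)
    let C := insert v s.candidates
    let X := largestDensest N C
    if (ρ : ENNReal) ≤ density N X then ⟨s.kernel ∪ X, C \ X⟩ else ⟨s.kernel, C⟩

/-- The kernel built when the elements are processed in the order given by the list `l`:
start with `V' = C = ∅`, run the main loop, and finally return `V' ∪ C`. -/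
noncomputable def buildKernel {V : Type*} [DecidableEq V] (M : Matroid V) (ρ : ℕ)
    (l : List V) : Finset V :=
  let s := l.foldl (kernelStep M ρ) ⟨∅, ∅⟩
  s.kernel ∪ s.candidates

/-- The total weight `w(A)` of a set `A` of hyperedges. -/
def weight {V : Type*} (w : Finset V → ℝ) (A : Finset (Finset V)) : ℝ :=
  ∑ e ∈ A, w e

/-- `δ(v)`: the hyperedges incident to `v`. -/
def incident {V : Type*} [DecidableEq V] (E : Finset (Finset V)) (v : V) : Finset (Finset V) :=
  E.filter (fun e => v ∈ e)

/-- The weighted degree of a vertex. -/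
def wdeg {V : Type*} [DecidableEq V] (E : Finset (Finset V)) (w : Finset V → ℝ) (v : V) : ℝ :=
  weight w (incident E v)

/-- `E(S)`: the hyperedges having at least one endpoint in `S`. -/
def covered {V : Type*} [DecidableEq V] (E : Finset (Finset V)) (S : Finset V) :
    Finset (Finset V) :=
  E.filter (fun e => (e ∩ S).Nonempty)

/-- `O` is an optimal solution of the matroid-constrained maximum coverage problem. -/
def IsOptimal {V : Type*} [DecidableEq V] (M : Matroid V) (E : Finset (Finset V))
    (w : Finset V → ℝ) (O : Finset V) : Prop :=
  M.Indep (O : Set V) ∧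
    ∀ S : Finset V, M.Indep (S : Set V) → weight w (covered E S) ≤ weight w (covered E O)

/-- `l` lists every vertex exactly once, by non-increasing weighted degree. -/
def IsDegreeOrder {V : Type*} [DecidableEq V] (E : Finset (Finset V)) (w : Finset V → ℝ)
    (l : List V) : Prop :=
  l.Nodup ∧ (∀ v, v ∈ l) ∧ l.Pairwise (fun u v => wdeg E w v ≤ wdeg E w u)

end MatroidCoverage

/-! Let A be the returned set, P = O ∩ A, and let S maximise the coverage among independent T with P
⊆ T ⊆ A. Write d(v) for the weighted degree and m(v) for the weight of the edges at v that S \ {v}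
misses. The loss of O \ A is paid for by S \ P and by a vector 0 ≤ y ≤ 1/ρ, which
`exists_fractional` builds by spreading the rank of each moved set X in the current contraction
evenly over X.

Fix t ≥ 0. Vertices of degree above t are processed first; the kernel K built from them satisfies
y(K) = rk K and spans those of them that are skipped. Optimality of S under exchanges
(`mem_closure_of_lt_privateEdges`) makes P and {s ∈ S : m(s) > t} span U = {b ∈ A : m(b) > t}.
Submodularity for P ∪ U and K then bounds the number of o ∈ O \ A with d(o) > t by the number of s ∈
S \ P with m(s) > t plus y(K \ (P ∪ U)) (`card_superlevel_le`). Integrating over t gives d(O \ A) ≤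
m(S \ P) + ∑_{b ∉ P} y(b)(d(b) - m(b)) (`sum_wdeg_le`). As y ≤ 1/ρ, `edge_bound` yields, edge by
edge, w(E(O)) ≤ (1 + (μ-1)/ρ) w(E(S)), and w(E(S)) ≤ w(E(O)) finishes. -/

namespace MatroidCoverage

open Finset

variable {V : Type*}

/-! ### Real-valued rank, contraction and density -/

/-- The rank of a finite set, as a real number. -/
noncomputable def rk (M : Matroid V) (S : Finset V) : ℝ := ((M.eRk (S : Set V)).toNat : ℝ)

theorem eRk_ne_top (M : Matroid V) (S : Finset V) : M.eRk (S : Set V) ≠ ⊤ :=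
  Matroid.eRk_ne_top_iff.2 (M.isRkFinite_of_finite S.finite_toSet)

theorem exists_eRk_eq (M : Matroid V) (S : Finset V) :
    ∃ n : ℕ, M.eRk (S : Set V) = n ∧ rk M S = n := by
  obtain ⟨n, hn⟩ := ENat.ne_top_iff_exists.1 (eRk_ne_top M S)
  exact ⟨n, hn.symm, by simp [rk, ← hn]⟩

theorem rk_nonneg (M : Matroid V) (S : Finset V) : 0 ≤ rk M S := Nat.cast_nonneg _

theorem rk_mono (M : Matroid V) {S T : Finset V} (h : (S : Set V) ⊆ M.closure (T : Set V)) :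
    rk M S ≤ rk M T := by
  obtain ⟨a, ha, ha'⟩ := exists_eRk_eq M S
  obtain ⟨b, hb, hb'⟩ := exists_eRk_eq M T
  have := M.eRk_mono h
  rw [Matroid.eRk_closure_eq, ha, hb] at this
  rw [ha', hb']
  exact_mod_cast this

theorem rk_submodular [DecidableEq V] (M : Matroid V) (S T : Finset V) :
    rk M (S ∩ T) + rk M (S ∪ T) ≤ rk M S + rk M T := by
  obtain ⟨a, ha, ha'⟩ := exists_eRk_eq M S
  obtain ⟨b, hb, hb'⟩ := exists_eRk_eq M T
  obtain ⟨c, hc, hc'⟩ := exists_eRk_eq M (S ∩ T)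
  obtain ⟨d, hd, hd'⟩ := exists_eRk_eq M (S ∪ T)
  have := M.eRk_inter_add_eRk_union_le (S : Set V) (T : Set V)
  rw [← coe_inter, ← coe_union, ha, hb, hc, hd] at this
  rw [ha', hb', hc', hd']
  exact_mod_cast this

theorem rk_of_indep (M : Matroid V) {S : Finset V} (h : M.Indep (S : Set V)) :
    rk M S = S.card := by
  simp [rk, h.eRk_eq_encard]

theorem rk_empty (M : Matroid V) : rk M ∅ = 0 := by simp [rk]

/-- A basis of `K` extends to a basis `I` of `K ∪ X`, and `I \ K` is then a basis of `X` in the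
contraction. -/
theorem rk_contract [DecidableEq V] (M : Matroid V) (hM : M.E = Set.univ) {K X : Finset V}
    (h : Disjoint K X) :
    rk (M.contract (K : Set V)) X = rk M (K ∪ X) - rk M K := by
  obtain ⟨J, hJ⟩ := M.exists_isBasis (K : Set V) (by simp [hM])
  obtain ⟨I, hI, hIJ⟩ := hJ.exists_isBasis_inter_eq_of_superset
    (show (K : Set V) ⊆ ((K ∪ X : Finset V) : Set V) by simp) (by simp [hM])
  have hsplit : I \ K ∪ J = I := by rw [← hIJ]; exact Set.sdiff_union_inter I _
  have hb := hI.contract_isBasis hJ (by rw [hsplit]; exact hI.indep)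
  have hX : ((K ∪ X : Finset V) : Set V) \ K = X := by
    rw [← coe_sdiff, union_sdiff_cancel_left h]
  rw [hX] at hb
  have hadd : (I \ K).encard + J.encard = I.encard := by
    conv_rhs => rw [← hsplit]
    refine (Set.encard_union_eq ?_).symm
    exact Set.disjoint_of_subset_right hJ.subset Set.disjoint_sdiff_left
  obtain ⟨a, ha, ha'⟩ := exists_eRk_eq (M.contract (K : Set V)) X
  obtain ⟨b, hb', hb''⟩ := exists_eRk_eq M (K ∪ X)
  obtain ⟨c, hc, hc'⟩ := exists_eRk_eq M K
  rw [hb.encard_eq_eRk, hJ.encard_eq_eRk, hI.encard_eq_eRk, ha, hb', hc] at hadd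
  rw [ha', hb'', hc', eq_sub_iff_add_eq]
  exact_mod_cast hadd

theorem mul_rk_le_card_of_le_density (M : Matroid V) {X : Finset V} {ρ : ℕ}
    (h : (ρ : ENNReal) ≤ density M X) : ρ * rk M X ≤ X.card := by
  obtain ⟨a, ha, ha'⟩ := exists_eRk_eq M X
  rw [density, ha, ENat.toENNReal_coe] at h
  have := (ENNReal.mul_le_of_le_div h)
  rw [ha']
  exact_mod_cast this

theorem nonempty_of_le_density (M : Matroid V) {X : Finset V} {ρ : ℕ} (hρ : 0 < ρ)
    (h : (ρ : ENNReal) ≤ density M X) : X.Nonempty := by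
  by_contra hX
  rw [not_nonempty_iff_eq_empty.1 hX, density_empty] at h
  simp at h
  omega

theorem IsDensest.card_mul_rk_le {M : Matroid V} {C X : Finset V} (h : IsDensest M C X)
    {U : Finset V} (hU : U ⊆ X) : U.card * rk M X ≤ X.card * rk M U := by
  obtain ⟨a, ha, ha'⟩ := exists_eRk_eq M X
  obtain ⟨b, hb, hb'⟩ := exists_eRk_eq M U
  have hd := h.2 U (hU.trans h.1)
  rw [density, density, ha, hb, ENat.toENNReal_coe, ENat.toENNReal_coe] at hd
  rw [ha', hb']
  rcases Nat.eq_zero_or_pos a with rfl | ha0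
  · simp; positivity
  rcases Nat.eq_zero_or_pos b with rfl | hb0
  · rcases Nat.eq_zero_or_pos U.card with hc | hc
    · simp [hc]
    -- A nonempty `U` of rank `0` would have density `⊤`, above the finite density of `X`.
    · have h1 : ((U.card : ℕ) : ENNReal) / ((0 : ℕ) : ENNReal) = ⊤ := by
        rw [Nat.cast_zero]; exact ENNReal.div_zero (by exact_mod_cast hc.ne')
      rw [h1, top_le_iff] at hd
      exact absurd hd (ENNReal.div_lt_top (by simp) (by exact_mod_cast ha0.ne')).ne
  · have h0 : (a : ENNReal) ≠ 0 := by exact_mod_cast ha0.ne'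
    have h1 : (b : ENNReal) ≠ 0 := by exact_mod_cast hb0.ne'
    rw [ENNReal.div_le_iff h1 (by simp), ENNReal.div_eq_inv_mul, mul_assoc,
      ← ENNReal.div_eq_inv_mul, ENNReal.le_div_iff_mul_le (by simp [h0]) (by simp)] at hd
    exact_mod_cast hd

variable [DecidableEq V]

/-! ### Invariants of the main loop -/

/-- The state of the main loop after the elements of `l` have been processed. -/
noncomputable def kernelState (M : Matroid V) (ρ : ℕ) (l : List V) : KernelState V :=
  l.foldl (kernelStep M ρ) ⟨∅, ∅⟩

/-- All elements kept in a state. -/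
def KernelState.kept (s : KernelState V) : Finset V := s.kernel ∪ s.candidates

theorem kernelState_append_singleton (M : Matroid V) (ρ : ℕ) (l : List V) (v : V) :
    kernelState M ρ (l ++ [v]) = kernelStep M ρ (kernelState M ρ l) v := by
  simp [kernelState]

/-- This isolates what the fractional vector needs when the kernel grows. `X` avoids the old kernel
because an unspanned vertex lies outside it, and `ρ > 0` rules out an empty `X`. -/
theorem kernelStep_kernel (M : Matroid V) {ρ : ℕ} (hρ : 0 < ρ) {s : KernelState V}
    (hs : Disjoint s.kernel s.candidates) (hK : (s.kernel : Set V) ⊆ M.E) (v : V) :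
    (kernelStep M ρ s v).kernel = s.kernel ∨
      ∃ X : Finset V, X.Nonempty ∧ Disjoint s.kernel X ∧
        (kernelStep M ρ s v).kernel = s.kernel ∪ X ∧
        ρ * rk (M.contract (s.kernel : Set V)) X ≤ X.card ∧
        ∀ U ⊆ X, U.card * rk (M.contract (s.kernel : Set V)) X ≤
          X.card * rk (M.contract (s.kernel : Set V)) U := by
  unfold kernelStep
  split_ifs with h1
  · exact Or.inl rfl
  · dsimp only
    set N := M.contract (s.kernel : Set V)
    set C := insert v s.candidates
    set X := largestDensest N C
    split_ifs with h2
    · refine Or.inr ⟨X, nonempty_of_le_density N hρ h2, ?_, rfl,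
        mul_rk_le_card_of_le_density N h2,
        fun U hU => (largestDensest_spec N C).1.card_mul_rk_le hU⟩
      refine disjoint_of_subset_right (largestDensest_spec N C).1.1 ?_
      exact disjoint_insert_right.2 ⟨fun h => h1 (M.subset_closure _ hK h), hs⟩
    · exact Or.inl rfl

theorem kernelStep_disjoint (M : Matroid V) (ρ : ℕ) {s : KernelState V}
    (hs : Disjoint s.kernel s.candidates) (hK : (s.kernel : Set V) ⊆ M.E) (v : V) :
    Disjoint (kernelStep M ρ s v).kernel (kernelStep M ρ s v).candidates := by
  unfold kernelStep
  split_ifs with h1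
  · exact hs
  · dsimp only
    set N := M.contract (s.kernel : Set V)
    set C := insert v s.candidates
    set X := largestDensest N C
    have hC : Disjoint s.kernel C :=
      disjoint_insert_right.2 ⟨fun h => h1 (M.subset_closure _ hK h), hs⟩
    split_ifs
    · exact disjoint_union_left.2 ⟨hC.mono_right sdiff_subset, disjoint_sdiff⟩
    · exact hC

theorem kernelStep_kernel_mono (M : Matroid V) (ρ : ℕ) (s : KernelState V) (v : V) :
    s.kernel ⊆ (kernelStep M ρ s v).kernel := by
  unfold kernelStep
  split_ifs with h1
  · exact Subset.rfl
  · dsimp only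
    set N := M.contract (s.kernel : Set V)
    set C := insert v s.candidates
    set X := largestDensest N C
    split_ifs
    · exact subset_union_left
    · exact Subset.rfl

theorem kernelStep_kept (M : Matroid V) (ρ : ℕ) (s : KernelState V) (v : V) :
    (v ∈ M.closure (s.kernel : Set V) ∧ (kernelStep M ρ s v).kept = s.kept) ∨
      (kernelStep M ρ s v).kept = insert v s.kept := by
  unfold kernelStep
  split_ifs with h1
  · exact Or.inl ⟨h1, rfl⟩
  · dsimp only
    set N := M.contract (s.kernel : Set V)
    set C := insert v s.candidates
    set X := largestDensest N C
    right
    have hX : X ⊆ C := (largestDensest_spec N C).1.1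
    split_ifs
    · simp only [KernelState.kept]
      rw [union_assoc, union_sdiff_of_subset hX, union_insert]
    · simp only [KernelState.kept]
      rw [union_insert]

theorem kernelState_disjoint (M : Matroid V) (hM : M.E = Set.univ) (ρ : ℕ) (l : List V) :
    Disjoint (kernelState M ρ l).kernel (kernelState M ρ l).candidates := by
  induction l using List.reverseRecOn with
  | nil => simp [kernelState]
  | append_singleton l v ih =>
    rw [kernelState_append_singleton]
    exact kernelStep_disjoint M ρ ih (by simp [hM]) v

theorem kernelState_kept_subset (M : Matroid V) (ρ : ℕ) (l : List V) :
    (kernelState M ρ l).kept ⊆ l.toFinset := by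
  induction l using List.reverseRecOn with
  | nil => simp [kernelState, KernelState.kept]
  | append_singleton l v ih =>
    rw [kernelState_append_singleton]
    intro x hx
    rcases kernelStep_kept M ρ (kernelState M ρ l) v with ⟨-, h⟩ | h <;> rw [h] at hx
    · have := ih hx
      simp_all
    · rcases mem_insert.1 hx with rfl | hx
      · simp
      · have := ih hx
        simp_all

theorem kernelState_kept_mono (M : Matroid V) (ρ : ℕ) (l l' : List V) :
    (kernelState M ρ l).kept ⊆ (kernelState M ρ (l ++ l')).kept := by
  induction l' using List.reverseRecOn with
  | nil => simp
  | append_singleton l' v ih =>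
    rw [← List.append_assoc, kernelState_append_singleton]
    refine ih.trans ?_
    rcases kernelStep_kept M ρ (kernelState M ρ (l ++ l')) v with ⟨-, h⟩ | h <;> rw [h]
    exact subset_insert _ _

/-- Moving `X` between the two sets preserves their union, so a processed vertex is missing only if
it was skipped; later kernels only enlarge the span. -/
theorem mem_closure_of_notMem_kept (M : Matroid V) (ρ : ℕ) {l : List V} {v : V} (hv : v ∈ l)
    (h : v ∉ (kernelState M ρ l).kept) :
    v ∈ M.closure ((kernelState M ρ l).kernel : Set V) := by
  induction l using List.reverseRecOn with
  | nil => simp at hv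
  | append_singleton l u ih =>
    rw [kernelState_append_singleton] at h ⊢
    have hmono := M.closure_subset_closure
      (coe_subset.2 (kernelStep_kernel_mono M ρ (kernelState M ρ l) u))
    rcases List.mem_append.1 hv with hv | hv
    · refine hmono (ih hv fun hmem => h ?_)
      have := kernelState_kept_mono M ρ l [u] hmem
      rwa [kernelState_append_singleton] at this
    · obtain rfl : v = u := by simpa using hv
      rcases kernelStep_kept M ρ (kernelState M ρ l) v with ⟨hc, -⟩ | hk
      · exact hmono hc
      · exact absurd (hk ▸ mem_insert_self _ _) h

/-! ### The fractional independent vector -/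

/-- The kernel carries a fractional independent vector with small entries, for which the kernel of
every initial segment is tight. -/
theorem exists_fractional (M : Matroid V) (hM : M.E = Set.univ) {ρ : ℕ} (hρ : 0 < ρ)
    (l : List V) :
    ∃ y : V → ℝ, (∀ v, 0 ≤ y v) ∧ (∀ v, ρ * y v ≤ 1) ∧
      (∀ v, v ∉ (kernelState M ρ l).kernel → y v = 0) ∧
      (∀ W : Finset V, ∑ v ∈ W, y v ≤ rk M W) ∧
      ∀ l', l' <+: l →
        ∑ v ∈ (kernelState M ρ l').kernel, y v = rk M (kernelState M ρ l').kernel := by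
  induction l using List.reverseRecOn with
  | nil =>
    refine ⟨fun _ => 0, by simp, by simp, by simp, by simp [rk_nonneg], ?_⟩
    intro l' hl'
    obtain rfl := List.prefix_nil.1 hl'
    simp [kernelState, rk_empty]
  | append_singleton l u ih =>
    obtain ⟨y, hy0, hy1, hys, hyW, hyt⟩ := ih
    have hdisj := kernelState_disjoint M hM ρ l
    rcases kernelStep_kernel M hρ hdisj (by simp [hM]) u with hk | ⟨X, hX, hKX, hk, hXρ, hXU⟩ <;>
      rw [← kernelState_append_singleton] at hk
    · refine ⟨y, hy0, hy1, by rwa [hk], hyW, fun l' hl' => ?_⟩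
      rcases List.prefix_concat_iff.1 hl' with rfl | hl'
      · rw [hk]; exact hyt l (List.prefix_refl l)
      · exact hyt l' hl'
    · set K := (kernelState M ρ l).kernel with hKdef
      set r := rk (M.contract (K : Set V)) X with hr
      have hr0 : 0 ≤ r := rk_nonneg _ _
      have hXpos : (0 : ℝ) < X.card := by exact_mod_cast hX.card_pos
      have hyX : ∀ v ∈ X, y v = 0 := fun v hv => hys v (disjoint_right.1 hKX hv)
      have hsum : ∀ W : Finset V, ∑ v ∈ W, (y v + if v ∈ X then r / X.card else 0) =
          ∑ v ∈ W ∩ K, y v + (W ∩ X).card * (r / X.card) := by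
        intro W
        rw [sum_add_distrib, sum_ite_mem, sum_const, nsmul_eq_mul]
        congr 1
        refine (sum_subset inter_subset_left fun v hv hv' => hys v fun h => hv' ?_).symm
        exact mem_inter.2 ⟨hv, h⟩
      have htK := hyt l (List.prefix_refl l)
      -- The new rank `r` is spread evenly over `X`; `ρ * r ≤ |X|` keeps the entries at most `1/ρ`.
      refine ⟨fun v => y v + if v ∈ X then r / X.card else 0, ?_, ?_, ?_, ?_, ?_⟩
      · intro v
        have := hy0 v
        dsimp only
        split_ifs <;> positivity
      · intro v
        dsimp only
        split_ifs with hv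
        · rw [hyX v hv, zero_add, mul_div_assoc', div_le_one hXpos]
          exact hXρ
        · simpa using hy1 v
      · intro v hv
        rw [hk, mem_union, not_or] at hv
        simp [hys v hv.1, hv.2]
      · intro W
        rw [hsum]
        -- The old part of `W` is bounded by rk(W ∩ K). Since `X` is densest, `W ∩ X` receives at
        -- most its own rank in the contraction, hence at most rk(W ∪ K) - rk K; submodularity adds
        -- the two.
        have h1 := hyW (W ∩ K)
        have h2 := hXU (W ∩ X) inter_subset_right
        rw [rk_contract M hM (hKX.mono_right inter_subset_right)] at h2
        have h3 : ((W ∩ X).card : ℝ) * (r / X.card) ≤ rk M (K ∪ W ∩ X) - rk M K := by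
          rw [mul_div_assoc', div_le_iff₀ hXpos]
          linarith
        have h4 := rk_submodular M W K
        have h5 : rk M (K ∪ W ∩ X) ≤ rk M (W ∪ K) := by
          refine rk_mono M (Set.Subset.trans ?_ (M.subset_closure _ (by simp [hM])))
          intro x hx
          simp at hx ⊢
          tauto
        linarith
      · intro l' hl'
        rcases List.prefix_concat_iff.1 hl' with rfl | hl'
        · rw [hk, hsum, union_inter_cancel_left, union_inter_cancel_right, htK, mul_div_assoc',
            mul_div_cancel_left₀ _ hXpos.ne', hr, rk_contract M hM hKX]
          ring
        -- Earlier kernels lie in `K`, so they miss `X` and their tightness is unaffected.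
        · rw [← hyt l' hl']
          refine sum_congr rfl fun v hv => ?_
          have hvK : v ∈ K := by
            obtain ⟨l'', rfl⟩ := hl'
            clear * - hv hKdef
            rw [hKdef]
            clear hKdef
            induction l'' using List.reverseRecOn with
            | nil => simpa using hv
            | append_singleton l'' a ih =>
              rw [← List.append_assoc, kernelState_append_singleton]
              exact kernelStep_kernel_mono M ρ _ _ ih
          simp [disjoint_left.1 hKX hvK]

end MatroidCoverage

namespace MatroidCoverage

open Finset

/-! ### Integration over levels -/

/-- A comparison of two families of superlevel sets integrates to a comparison of linear
functionals. -/
theorem sum_mul_nonneg_of_superlevel {ι : Type*} (s : Finset ι) (p q α β : ι → ℝ)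
    (hα : ∀ i ∈ s, 0 ≤ α i) (hβ : ∀ i ∈ s, 0 ≤ β i)
    (h : ∀ t : ℝ, 0 ≤ t → 0 ≤ ∑ i ∈ s, (p i * (if t < α i then 1 else 0) +
      q i * (if t < β i then 1 else 0))) :
    0 ≤ ∑ i ∈ s, (p i * α i + q i * β i) := by
  -- `T` bounds every value, so each `a` among them is the integral of the indicator of `t < a` over
  -- `[0, T]`.
  set T : ℝ := ∑ i ∈ s, (α i + β i) with hT
  have hT0 : 0 ≤ T := sum_nonneg fun i hi => add_nonneg (hα i hi) (hβ i hi)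
  have hle : ∀ i ∈ s, α i + β i ≤ T := fun i hi =>
    single_le_sum (f := fun i => α i + β i) (fun i hi => add_nonneg (hα i hi) (hβ i hi)) hi
  have hind : ∀ a : ℝ, (fun t : ℝ => if t < a then (1 : ℝ) else 0) =
      (Set.Iio a).indicator fun _ => 1 := by
    intro a
    ext t
    simp [Set.indicator_apply]
  have hint : ∀ a : ℝ, IntervalIntegrable (fun t : ℝ => if t < a then (1 : ℝ) else 0)
      MeasureTheory.volume 0 T := by
    intro a
    rw [hind, intervalIntegrable_iff, Set.uIoc_of_le hT0]
    exact (MeasureTheory.integrable_const 1).indicator measurableSet_Iio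
  have hval : ∀ a : ℝ, 0 ≤ a → a ≤ T → ∫ t in (0 : ℝ)..T, (if t < a then (1 : ℝ) else 0) = a := by
    intro a ha haT
    rw [← intervalIntegral.integral_add_adjacent_intervals
      ((hint a).mono_set (by rw [Set.uIcc_of_le ha, Set.uIcc_of_le hT0]; gcongr))
      ((hint a).mono_set (b := T) (a := 0) (c := a) (d := T)
        (by rw [Set.uIcc_of_le haT, Set.uIcc_of_le hT0]; gcongr))]
    have h1 : ∫ t in (0 : ℝ)..a, (if t < a then (1 : ℝ) else 0) = ∫ t in (0 : ℝ)..a, (1 : ℝ) := by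
      refine intervalIntegral.integral_congr_Ioo_of_le ha fun t ht => ?_
      simp [ht.2]
    have h2 : ∫ t in a..T, (if t < a then (1 : ℝ) else 0) = ∫ t in a..T, (0 : ℝ) := by
      refine intervalIntegral.integral_congr fun t ht => ?_
      rw [Set.uIcc_of_le haT] at ht
      simp [ht.1]
    rw [h1, h2]
    simp
  have hnn : 0 ≤ ∫ t in (0 : ℝ)..T, ∑ i ∈ s, (p i * (if t < α i then 1 else 0) +
      q i * (if t < β i then 1 else 0)) :=
    intervalIntegral.integral_nonneg hT0 fun t ht => h t ht.1
  rw [intervalIntegral.integral_finsetSum fun i _ =>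
    ((hint _).const_mul _).add ((hint _).const_mul _)] at hnn
  refine hnn.trans_eq (sum_congr rfl fun i hi => ?_)
  have h1 := hα i hi
  have h2 := hβ i hi
  have h3 := hle i hi
  rw [intervalIntegral.integral_add ((hint _).const_mul _) ((hint _).const_mul _),
    intervalIntegral.integral_const_mul, intervalIntegral.integral_const_mul,
    hval _ h1 (by linarith), hval _ h2 (by linarith)]

variable {V : Type*}

/-! ### Coverage, private edges and exchanges -/

theorem weight_nonneg {w : Finset V → ℝ} {A : Finset (Finset V)} (h : ∀ e ∈ A, 0 ≤ w e) :
    0 ≤ weight w A :=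
  sum_nonneg h

theorem weight_mono {E : Finset (Finset V)} {w : Finset V → ℝ} (hw : ∀ e ∈ E, 0 ≤ w e)
    {A B : Finset (Finset V)} (hAB : A ⊆ B) (hB : B ⊆ E) : weight w A ≤ weight w B :=
  sum_le_sum_of_subset_of_nonneg hAB fun e he _ => hw e (hB he)

/-- Double counting: exchanging a sum over vertices with a sum over the selected hyperedges. -/
theorem sum_weight_filter (E : Finset (Finset V)) (w : Finset V → ℝ) (S : Finset V)
    (r : V → Finset V → Prop) [∀ v e, Decidable (r v e)] :
    ∑ v ∈ S, weight w (E.filter (r v)) =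
      ∑ e ∈ E, w e * ((S.filter fun v => r v e).card : ℝ) := by
  simp_rw [weight, sum_filter]
  rw [sum_comm]
  refine sum_congr rfl fun e _ => ?_
  rw [← sum_filter, sum_const, nsmul_eq_mul, mul_comm]

variable [DecidableEq V]

/-- The hyperedges at `v` that `S \ {v}` does not cover. -/
def privateEdges (E : Finset (Finset V)) (S : Finset V) (v : V) : Finset (Finset V) :=
  E.filter (fun e => v ∈ e ∧ Disjoint e (S.erase v))

theorem weight_covered_insert (E : Finset (Finset V)) (w : Finset V → ℝ) (T : Finset V) (v : V) :
    weight w (covered E (insert v T)) =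
      weight w (covered E T) + weight w (E.filter fun e => v ∈ e ∧ Disjoint e T) := by
  unfold weight covered
  rw [← sum_union]
  · congr 1
    ext e
    simp only [mem_filter, mem_union, ← not_disjoint_iff_nonempty_inter, disjoint_insert_right]
    tauto
  · refine disjoint_filter.2 fun e _ h1 h2 => ?_
    exact (not_disjoint_iff_nonempty_inter.2 h1) h2.2

/-- A maximiser of the coverage among the independent sets between `P` and `A` spans `A` level by
level, with respect to the weight of the private edges. -/
theorem mem_closure_of_lt_privateEdges (M : Matroid V) (hM : M.E = Set.univ)
    {E : Finset (Finset V)} {w : Finset V → ℝ} (hw : ∀ e ∈ E, 0 ≤ w e) {P A S : Finset V}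
    (hPS : P ⊆ S) (hSA : S ⊆ A) (hS : M.Indep (S : Set V))
    (hmax : ∀ T : Finset V, P ⊆ T → T ⊆ A → M.Indep (T : Set V) →
      weight w (covered E T) ≤ weight w (covered E S))
    {t : ℝ} (ht : 0 ≤ t) {b : V} (hb : b ∈ A) (hbt : t < weight w (privateEdges E S b)) :
    b ∈ M.closure
      ((P ∪ S.filter fun s => t < weight w (privateEdges E S s) : Finset V) : Set V) := by
  set Q := P ∪ S.filter fun s => t < weight w (privateEdges E S s) with hQ
  by_contra hcon
  have hbS : b ∉ S := fun h => hcon <| M.subset_closure _ (by simp [hM]) <| by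
    simp [hQ, h, hbt]
  have hbins : weight w (covered E (insert b S)) =
      weight w (covered E S) + weight w (privateEdges E S b) := by
    rw [weight_covered_insert, privateEdges, erase_eq_of_notMem hbS]
  -- Otherwise adding `b` to `S` would be feasible and gain more than `t ≥ 0`.
  have hbcl : b ∈ M.closure (S : Set V) := by
    by_contra hncl
    have hind : M.Indep ((insert b S : Finset V) : Set V) := by
      rw [coe_insert]
      exact (hS.notMem_closure_iff_of_notMem (by simpa using hbS) (by simp [hM])).1 hncl
    have := hmax _ (hPS.trans (subset_insert _ _)) (insert_subset hb hSA) hind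
    linarith
  have hcirc := hS.fundCircuit_isCircuit hbcl (by simpa using hbS)
  -- Since `Q` does not span `b`, the fundamental circuit contains some `s` of `S` outside `Q`, so
  -- with private weight at most `t`.
  have hnot : ¬ (M.fundCircuit b S) \ {b} ⊆ (Q : Set V) := fun hsub =>
    hcon (M.closure_subset_closure hsub (hcirc.mem_closure_sdiff_singleton_of_mem
      (M.mem_fundCircuit b S)))
  obtain ⟨s, ⟨hs, hsb⟩, hsQ⟩ := Set.not_subset.1 hnot
  have hsb' : s ≠ b := hsb
  have hsS : s ∈ S := by
    rcases M.fundCircuit_subset_insert b S hs with h | h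
    · exact absurd h hsb
    · exact h
  have hsP : s ∉ P := fun h => hsQ (by simp [hQ, h])
  have hst : weight w (privateEdges E S s) ≤ t := by
    by_contra hlt
    exact hsQ (by simpa [hQ, hsS] using Or.inr (not_le.1 hlt))
  have hind := (hS.mem_fundCircuit_iff hbcl (by simpa using hbS)).1 hs
  have hT : ((insert b (S.erase s) : Finset V) : Set V) = insert b (S : Set V) \ {s} := by
    ext x
    simp only [coe_insert, coe_erase, Set.mem_insert_iff, Set.mem_sdiff, Set.mem_singleton_iff,
      mem_coe]
    constructor
    · rintro (rfl | h)
      · exact ⟨Or.inl rfl, hsb'.symm⟩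
      · exact ⟨Or.inr h.1, h.2⟩
    · rintro ⟨rfl | h, h'⟩
      · exact Or.inl rfl
      · exact Or.inr ⟨h, h'⟩
  -- Swapping `s` for `b` loses at most `t` and gains more than `t`.
  have hle := hmax (insert b (S.erase s))
    ((subset_erase.2 ⟨hPS, hsP⟩).trans (subset_insert _ _))
    (insert_subset hb ((erase_subset _ _).trans hSA)) (by rw [hT]; exact hind)
  have hs1 : weight w (covered E S) =
      weight w (covered E (S.erase s)) + weight w (privateEdges E S s) := by
    conv_lhs => rw [← insert_erase hsS]
    rw [weight_covered_insert, privateEdges]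
  rw [weight_covered_insert] at hle
  have hmono : weight w (privateEdges E S b) ≤
      weight w (E.filter fun e => b ∈ e ∧ Disjoint e (S.erase s)) := by
    refine weight_mono hw (fun e he => ?_) (filter_subset _ _)
    rw [privateEdges, erase_eq_of_notMem hbS, mem_filter] at he
    exact mem_filter.2 ⟨he.1, he.2.1, he.2.2.mono_right (erase_subset _ _)⟩
  linarith

/-- The contribution of a single hyperedge to the comparison of the optimum with `S`. -/
theorem edge_bound {P S Y e : Finset V} {μ ρ : ℕ} (hPS : P ⊆ S) (he : e.card ≤ μ) (hρ : 0 < ρ)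
    (hYP : Disjoint Y P) :
    (if (e ∩ P).Nonempty then 1 else 0) +
      (((S \ P).filter fun s => s ∈ e ∧ Disjoint e (S.erase s)).card : ℝ) +
      1 / ρ * ((Y.filter fun b => b ∈ e ∧ ¬ Disjoint e (S.erase b)).card : ℝ) ≤
    (1 + ((μ : ℝ) - 1) / ρ) * if (e ∩ S).Nonempty then 1 else 0 := by
  have hρ' : (1 : ℝ) ≤ ρ := by exact_mod_cast hρ
  set A := (S \ P).filter fun s => s ∈ e ∧ Disjoint e (S.erase s) with hA
  set B := Y.filter fun b => b ∈ e ∧ ¬ Disjoint e (S.erase b) with hB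
  have hBe : B ⊆ e := fun b hb => (mem_filter.1 hb).2.1
  have hBμ : (B.card : ℝ) ≤ μ := by exact_mod_cast (card_le_card hBe).trans he
  -- One vertex of `e` not counted in `B` is what turns `μ` into `μ - 1`.
  have hBμ1 : ∀ x ∈ e, x ∉ B → (B.card : ℝ) ≤ μ - 1 := by
    intro x hx hxB
    have h1 : (B.card + 1 : ℕ) ≤ μ :=
      (card_insert_of_notMem hxB ▸ card_le_card (insert_subset hx hBe)).trans he
    have h2 : ((B.card + 1 : ℕ) : ℝ) ≤ μ := by exact_mod_cast h1
    push_cast at h2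
    linarith
  have key : ∀ z : ℝ, (B.card : ℝ) ≤ z → 1 / (ρ : ℝ) * B.card ≤ z / ρ := by
    intro z hz
    rw [one_div_mul_eq_div]
    gcongr
  by_cases hS : (e ∩ S).Nonempty
  · rw [if_pos hS, mul_one]
    by_cases hP : (e ∩ P).Nonempty
    · rw [if_pos hP]
      obtain ⟨x, hx⟩ := hP
      rw [mem_inter] at hx
      have hA0 : A = ∅ := by
        refine filter_eq_empty_iff.2 fun s hs h => ?_
        rw [mem_sdiff] at hs
        refine disjoint_left.1 h.2 hx.1 (mem_erase.2 ⟨?_, hPS hx.2⟩)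
        rintro rfl
        exact hs.2 hx.2
      have := key _ (hBμ1 x hx.1 fun h => disjoint_left.1 hYP (mem_filter.1 h).1 hx.2)
      rw [hA0]
      simp only [card_empty, Nat.cast_zero, add_zero]
      linarith
    · rw [if_neg hP, zero_add]
      by_cases hA0 : A = ∅
      · rw [hA0, card_empty, Nat.cast_zero, zero_add]
        have := key _ hBμ
        -- Here `B` may be all of `e`, but the first two terms vanish and μ/ρ ≤ 1 + (μ-1)/ρ.
        have h2 : 1 / (ρ : ℝ) ≤ 1 := by
          rw [div_le_one (by linarith)]; exact hρ'
        rw [sub_div]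
        linarith
      · obtain ⟨x, hx⟩ := nonempty_iff_ne_empty.2 hA0
        have hx' := (mem_filter.1 hx).2
        have hA1 : A.card ≤ 1 := by
          refine card_le_one.2 fun a ha b hb => ?_
          by_contra hab
          have ha' := mem_filter.1 ha
          exact disjoint_left.1 (mem_filter.1 hb).2.2 ha'.2.1
            (mem_erase.2 ⟨hab, (mem_sdiff.1 ha'.1).1⟩)
        have hA1' : (A.card : ℝ) ≤ 1 := by exact_mod_cast hA1
        have := key _ (hBμ1 x hx'.1 fun h => (mem_filter.1 h).2.2 hx'.2)
        linarith
  · have hd : Disjoint e S := by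
      by_contra h
      exact hS (not_disjoint_iff_nonempty_inter.1 h)
    have hP : ¬ (e ∩ P).Nonempty := fun h =>
      hS (h.mono (inter_subset_inter_left hPS))
    have hA0 : A = ∅ := by
      refine filter_eq_empty_iff.2 fun s hs h => ?_
      exact disjoint_left.1 hd h.1 (mem_sdiff.1 hs).1
    have hB0 : B = ∅ := by
      refine filter_eq_empty_iff.2 fun b _ h => ?_
      exact h.2 (hd.mono_right (erase_subset _ _))
    simp [hS, hP, hA0, hB0]

theorem weight_covered_eq (E : Finset (Finset V)) (w : Finset V → ℝ) (S : Finset V) :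
    weight w (covered E S) = ∑ e ∈ E, w e * if (e ∩ S).Nonempty then 1 else 0 := by
  simp [weight, covered, sum_filter]

theorem weight_covered_union_le {E : Finset (Finset V)} {w : Finset V → ℝ}
    (hw : ∀ e ∈ E, 0 ≤ w e) (P Q : Finset V) :
    weight w (covered E (P ∪ Q)) ≤ weight w (covered E P) + ∑ v ∈ Q, wdeg E w v := by
  induction Q using Finset.induction_on with
  | empty => simp
  | insert v Q hv ih =>
    rw [union_insert, weight_covered_insert, sum_insert hv]
    have : weight w (E.filter fun e => v ∈ e ∧ Disjoint e (P ∪ Q)) ≤ wdeg E w v :=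
      weight_mono hw (fun e he => by
        rw [mem_filter] at he
        exact mem_filter.2 ⟨he.1, he.2.1⟩) (filter_subset _ _)
    linarith

/-- The vertices of weighted degree above `t` form an initial segment of a degree order. -/
theorem IsDegreeOrder.exists_prefix {E : Finset (Finset V)} {w : Finset V → ℝ} {l : List V}
    (hl : IsDegreeOrder E w l) (t : ℝ) :
    ∃ l₁ l₂, l = l₁ ++ l₂ ∧ ∀ v, v ∈ l₁ ↔ t < wdeg E w v := by
  obtain ⟨-, hmem, hp⟩ := hl
  suffices ∀ l : List V, l.Pairwise (fun u v => wdeg E w v ≤ wdeg E w u) →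
      ∃ l₁ l₂, l = l₁ ++ l₂ ∧ ∀ v ∈ l, v ∈ l₁ ↔ t < wdeg E w v by
    obtain ⟨l₁, l₂, h, h'⟩ := this l hp
    exact ⟨l₁, l₂, h, fun v => h' v (hmem v)⟩
  intro l hp
  induction l with
  | nil => exact ⟨[], [], rfl, by simp⟩
  | cons a l ih =>
    rw [List.pairwise_cons] at hp
    obtain ⟨l₁, l₂, h, h'⟩ := ih hp.2
    by_cases ha : t < wdeg E w a
    · refine ⟨a :: l₁, l₂, by simp [h], fun v hv => ?_⟩
      rcases List.mem_cons.1 hv with rfl | hv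
      · simp [ha]
      · rw [List.mem_cons, h' v hv]
        refine ⟨?_, Or.inr⟩
        rintro (rfl | h)
        · exact ha
        · exact h
    · refine ⟨[], a :: l, rfl, fun v hv => ?_⟩
      simp only [List.not_mem_nil, false_iff]
      rcases List.mem_cons.1 hv with rfl | hv
      · exact ha
      · exact fun h => ha (h.trans_le (hp.1 v hv))

theorem weight_privateEdges_le_wdeg {E : Finset (Finset V)} {w : Finset V → ℝ}
    (hw : ∀ e ∈ E, 0 ≤ w e) (S : Finset V) (v : V) :
    weight w (privateEdges E S v) ≤ wdeg E w v :=
  weight_mono hw (fun e he => by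
    rw [privateEdges, mem_filter] at he
    exact mem_filter.2 ⟨he.1, he.2.1⟩) (filter_subset _ _)

theorem wdeg_eq_add (E : Finset (Finset V)) (w : Finset V → ℝ) (S : Finset V) (v : V) :
    wdeg E w v = weight w (privateEdges E S v) +
      weight w (E.filter fun e => v ∈ e ∧ ¬ Disjoint e (S.erase v)) := by
  simp only [wdeg, incident, privateEdges, weight, ← filter_filter]
  rw [sum_filter_add_sum_filter_not]

/-! ### Comparison at each level and its integral -/

/-- The comparison of superlevel sets behind the replacement of the elements of `O \ A`. -/
theorem card_superlevel_le (M : Matroid V) (hM : M.E = Set.univ) {O A S K : Finset V}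
    {d m y : V → ℝ} {t : ℝ}
    (hO : M.Indep (O : Set V)) (hS : M.Indep (S : Set V)) (hPS : O ∩ A ⊆ S)
    (hspan : ∀ b ∈ A, t < m b →
      b ∈ M.closure ((O ∩ A ∪ S.filter fun s => t < m s : Finset V) : Set V))
    (hyW : ∀ W : Finset V, ∑ v ∈ W, y v ≤ rk M W) (hyK : ∑ v ∈ K, y v = rk M K)
    (hOK : ∀ o ∈ O \ A, t < d o → o ∈ M.closure (K : Set V)) :
    (((O \ A).filter fun o => t < d o).card : ℝ) ≤
      ((S \ (O ∩ A)).filter fun s => t < m s).card +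
        ∑ v ∈ K \ (O ∩ A ∪ A.filter fun b => t < m b), y v := by
  set P := O ∩ A with hP
  set U := A.filter fun b => t < m b with hU
  set Q := P ∪ S.filter fun s => t < m s with hQ
  have hQcard : (Q.card : ℝ) = P.card + ((S \ P).filter fun s => t < m s).card := by
    have : Q = P ∪ (S \ P).filter fun s => t < m s := by
      ext x
      simp only [hQ, mem_union, mem_filter, mem_sdiff]
      tauto
    rw [this, card_union_of_disjoint
      (disjoint_of_subset_right (filter_subset _ _) disjoint_sdiff)]
    push_cast
    rfl
  have hQind : M.Indep (Q : Set V) :=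
    hS.subset (coe_subset.2 (union_subset hPS (filter_subset _ _)))
  set R := P ∪ (O \ A).filter fun o => t < d o with hR
  have hRcard : (R.card : ℝ) = P.card + ((O \ A).filter fun o => t < d o).card := by
    rw [hR, card_union_of_disjoint]
    · push_cast
      rfl
    · refine disjoint_left.2 fun x hx hx' => ?_
      exact (mem_sdiff.1 (mem_filter.1 hx').1).2 (mem_inter.1 hx).2
  have hRind : M.Indep (R : Set V) :=
    hO.subset (coe_subset.2 (union_subset inter_subset_left
      ((filter_subset _ _).trans sdiff_subset)))
  have h1 : rk M (P ∪ U) ≤ rk M Q := by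
    refine rk_mono M fun x hx => ?_
    rcases mem_union.1 (mem_coe.1 hx) with hx | hx
    · exact M.subset_closure _ (by simp [hM]) (by simp [hQ, hx])
    · exact hspan x (mem_filter.1 hx).1 (mem_filter.1 hx).2
  have h2 : rk M R ≤ rk M ((P ∪ U) ∪ K) := by
    refine rk_mono M fun x hx => ?_
    rcases mem_union.1 (mem_coe.1 hx) with hx | hx
    · exact M.subset_closure _ (by simp [hM]) (by simp [hx])
    · exact M.closure_subset_closure (coe_subset.2 subset_union_right) (hOK x (mem_filter.1 hx).1 (mem_filter.1 hx).2)
  -- As y(K) = rk K, the rank that `K` adds to `P ∪ U` is at most y(K \ (P ∪ U)).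
  have h3 := rk_submodular M (P ∪ U) K
  have h4 := hyW ((P ∪ U) ∩ K)
  have h5 : ∑ v ∈ K \ (P ∪ U), y v + ∑ v ∈ (P ∪ U) ∩ K, y v = ∑ v ∈ K, y v := by
    rw [inter_comm, add_comm]
    exact sum_inter_add_sum_sdiff _ _ _
  rw [rk_of_indep M hQind] at h1
  rw [rk_of_indep M hRind] at h2
  linarith

/-- The degrees lost with `O \ A` are made up for by private edges of `S` and by the fractional
vector. -/
theorem sum_wdeg_le [Fintype V] (M : Matroid V) (hM : M.E = Set.univ) {E : Finset (Finset V)}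
    {w : Finset V → ℝ} (hw : ∀ e ∈ E, 0 ≤ w e) {ρ : ℕ} {l : List V} (hl : IsDegreeOrder E w l)
    {O S : Finset V} {y : V → ℝ} (hO : M.Indep (O : Set V)) (hS : M.Indep (S : Set V))
    (hPS : O ∩ buildKernel M ρ l ⊆ S) (hSA : S ⊆ buildKernel M ρ l)
    (hmax : ∀ T : Finset V, O ∩ buildKernel M ρ l ⊆ T → T ⊆ buildKernel M ρ l →
      M.Indep (T : Set V) → weight w (covered E T) ≤ weight w (covered E S))
    (hy0 : ∀ v, 0 ≤ y v) (hyW : ∀ W : Finset V, ∑ v ∈ W, y v ≤ rk M W)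
    (hyt : ∀ l', l' <+: l →
      ∑ v ∈ (kernelState M ρ l').kernel, y v = rk M (kernelState M ρ l').kernel) :
    ∑ o ∈ O \ buildKernel M ρ l, wdeg E w o ≤
      ∑ s ∈ S \ (O ∩ buildKernel M ρ l), weight w (privateEdges E S s) +
        ∑ b ∈ univ \ (O ∩ buildKernel M ρ l),
          y b * weight w (E.filter fun e => b ∈ e ∧ ¬ Disjoint e (S.erase b)) := by
  set A := buildKernel M ρ l with hA
  set P := O ∩ A with hP
  set d := wdeg E w with hd
  set m := fun v => weight w (privateEdges E S v) with hm
  have hmd : ∀ v, m v ≤ d v := weight_privateEdges_le_wdeg hw S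
  have hm0 : ∀ v, 0 ≤ m v := fun v => weight_nonneg fun e he => hw e (mem_filter.1 he).1
  have hexp : ∀ f g : V → ℝ, ∑ v, (((if v ∈ univ \ P then y v else 0) -
      (if v ∈ O \ A then 1 else 0)) * f v +
      ((if v ∈ S \ P then 1 else 0) - (if v ∈ univ \ P then y v else 0)) * g v) =
      ∑ v ∈ univ \ P, y v * (f v - g v) + ∑ v ∈ S \ P, g v - ∑ v ∈ O \ A, f v := by
    intro f g
    have e1 : ∀ (B : Finset V) (h : V → ℝ), ∑ v ∈ B, h v = ∑ v, if v ∈ B then h v else 0 := by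
      intro B h
      simp
    rw [e1 (univ \ P), e1 (S \ P), e1 (O \ A), ← sum_add_distrib, ← sum_sub_distrib]
    refine sum_congr rfl fun v _ => ?_
    split_ifs <;> ring
  -- The coefficient of `d` is y - 1_{O \ A} and that of `m` is 1_{S \ P} - y, with `y` restricted
  -- to the complement of `P`.
  have hmain := sum_mul_nonneg_of_superlevel univ
    (fun v => (if v ∈ univ \ P then y v else 0) - (if v ∈ O \ A then 1 else 0))
    (fun v => (if v ∈ S \ P then 1 else 0) - (if v ∈ univ \ P then y v else 0)) d m
    (fun v _ => (hm0 v).trans (hmd v)) (fun v _ => hm0 v) ?_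
  · rw [hexp] at hmain
    have : ∑ b ∈ univ \ P, y b * (d b - m b) = ∑ b ∈ univ \ P,
        y b * weight w (E.filter fun e => b ∈ e ∧ ¬ Disjoint e (S.erase b)) := by
      refine sum_congr rfl fun b _ => ?_
      rw [hd, wdeg_eq_add E w S b]
      ring
    rw [this] at hmain
    linarith
  · intro t ht
    rw [hexp]
    obtain ⟨l₁, l₂, rfl, hl₁⟩ := hl.exists_prefix t
    set K := (kernelState M ρ l₁).kernel with hK
    have hKA : K ⊆ A := subset_union_left.trans (kernelState_kept_mono M ρ l₁ l₂)
    have hKd : ∀ v ∈ K, t < d v := fun v hv => (hl₁ v).1 <| List.mem_toFinset.1 <|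
      kernelState_kept_subset M ρ l₁ (subset_union_left hv)
    have hcard := card_superlevel_le M hM (K := K) (d := d) (m := m) (y := y) (t := t) hO hS hPS
      (fun b hb hbt => mem_closure_of_lt_privateEdges M hM hw hPS hSA hS hmax ht hb hbt) hyW
      (hyt l₁ (List.prefix_append l₁ l₂)) (fun o ho hot =>
        mem_closure_of_notMem_kept M ρ ((hl₁ o).2 hot) fun h =>
          (mem_sdiff.1 ho).2 (kernelState_kept_mono M ρ l₁ l₂ h))
    -- On the left-hand set m ≤ t < d, so the bracket is 1; elsewhere it is nonnegative because m ≤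
    -- d.
    have hsum : ∑ v ∈ K \ (P ∪ A.filter fun b => t < m b), y v ≤ ∑ v ∈ univ \ P,
        y v * ((if t < d v then 1 else 0) - (if t < m v then 1 else 0)) := by
      have hsub : K \ (P ∪ A.filter fun b => t < m b) ⊆ univ \ P :=
        sdiff_subset_sdiff (subset_univ _) subset_union_left
      refine le_trans (le_of_eq ?_) (sum_le_sum_of_subset_of_nonneg hsub ?_)
      · refine sum_congr rfl fun v hv => ?_
        simp only [mem_sdiff, mem_union, mem_filter, not_or, not_and] at hv
        rw [if_pos (hKd v hv.1), if_neg (hv.2.2 (hKA hv.1))]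
        ring
      · intro v _ _
        refine mul_nonneg (hy0 v) ?_
        by_cases h : t < m v
        · simp [h, h.trans_le (hmd v)]
        · simp only [h, if_false, sub_zero]
          split_ifs <;> norm_num
    rw [sum_boole, sum_boole]
    linarith

end MatroidCoverage

/-! ### The approximation bound -/

open MatroidCoverage Finset in
theorem mainTheorem4 {V : Type*} [Fintype V] [DecidableEq V]
    (M : Matroid V) (hM : M.E = Set.univ)
    (E : Finset (Finset V)) (w : Finset V → ℝ) (hw : ∀ e ∈ E, 0 ≤ w e)
    (μ : ℕ) (hμ : ∀ e ∈ E, e.card ≤ μ)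
    (ρ : ℕ) (hρ : 0 < ρ)
    (l : List V) (hl : MatroidCoverage.IsDegreeOrder E w l)
    (O : Finset V) (hO : MatroidCoverage.IsOptimal M E w O) :
    ∃ S : Finset V, S ⊆ MatroidCoverage.buildKernel M ρ l ∧ M.Indep (S : Set V) ∧
      (1 - ((μ : ℝ) - 1) / (ρ : ℝ)) * MatroidCoverage.weight w (MatroidCoverage.covered E O) ≤
        MatroidCoverage.weight w (MatroidCoverage.covered E S) := by
  classical
  obtain ⟨hOind, hOmax⟩ := hO
  obtain ⟨y, hy0, hy1, -, hyW, hyt⟩ := exists_fractional M hM hρ l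
  obtain ⟨S, hSmem, hSmax⟩ := ((buildKernel M ρ l).powerset.filter fun T =>
      O ∩ buildKernel M ρ l ⊆ T ∧ M.Indep (T : Set V)).exists_max_image
    (fun T => weight w (covered E T)) ⟨O ∩ buildKernel M ρ l, by
      simpa using hOind.subset Set.inter_subset_left⟩
  rw [mem_filter, mem_powerset] at hSmem
  obtain ⟨hSA, hPS, hS⟩ := hSmem
  refine ⟨S, hSA, hS, ?_⟩
  have hsum := sum_wdeg_le M hM hw hl hOind hS hPS hSA (fun T h1 h2 h3 =>
    hSmax T (by simp [h1, h2, h3])) hy0 hyW hyt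
  set A := buildKernel M ρ l
  set P := O ∩ A with hP
  have hρ' : (0 : ℝ) < ρ := by exact_mod_cast hρ
  have hO1 := weight_covered_union_le hw P (O \ A)
  have hOeq : P ∪ O \ A = O := by
    rw [hP, union_comm]; exact sdiff_union_inter O A
  rw [hOeq] at hO1
  have hy : ∑ b ∈ univ \ P, y b * weight w (E.filter fun e => b ∈ e ∧ ¬ Disjoint e (S.erase b)) ≤
      1 / ρ * ∑ b ∈ univ \ P, weight w (E.filter fun e => b ∈ e ∧ ¬ Disjoint e (S.erase b)) := by
    rw [mul_sum]
    refine sum_le_sum fun b _ => mul_le_mul_of_nonneg_right ?_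
      (weight_nonneg fun e he => hw e (mem_filter.1 he).1)
    rw [le_div_iff₀ hρ', mul_comm]
    exact hy1 b
  have hedge : weight w (covered E P) + ∑ s ∈ S \ P, weight w (privateEdges E S s) +
      1 / ρ * ∑ b ∈ univ \ P, weight w (E.filter fun e => b ∈ e ∧ ¬ Disjoint e (S.erase b)) ≤
      (1 + ((μ : ℝ) - 1) / ρ) * weight w (covered E S) := by
    simp only [privateEdges]
    rw [sum_weight_filter, sum_weight_filter, weight_covered_eq, weight_covered_eq, mul_sum,
      mul_sum, ← sum_add_distrib, ← sum_add_distrib]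
    refine sum_le_sum fun e he => ?_
    have := mul_le_mul_of_nonneg_left
      (edge_bound (Y := univ \ P) hPS (hμ e he) hρ sdiff_disjoint) (hw e he)
    linarith
  have hfO : weight w (covered E S) ≤ weight w (covered E O) := hOmax S hS
  have hf0 : 0 ≤ weight w (covered E S) := weight_nonneg fun e he => hw e (mem_filter.1 he).1
  -- For `μ = 0` the factor (μ-1)/ρ is negative and the last estimate fails, but every edge is empty
  -- and nothing is covered.
  rcases Nat.eq_zero_or_pos μ with rfl | hμ0
  · have hcov : covered E O = ∅ := by
      refine filter_eq_empty_iff.2 fun e he => ?_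
      simp [card_eq_zero.1 (Nat.le_zero.1 (hμ e he))]
    simpa [hcov, weight] using hf0
  · have hc : 0 ≤ ((μ : ℝ) - 1) / ρ := by
      have : (1 : ℝ) ≤ μ := by exact_mod_cast hμ0
      exact div_nonneg (by linarith) hρ'.le
    have := mul_le_mul_of_nonneg_left hfO hc
    linarith
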